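/- Let $T(x)=2x \pmod 1$ on the circle $S^1=\mathbb R/\mathbb Z$, with inverse branches $\tau_1(x)=x/2$, $\tau_2(x)=(x+1)/2$ on $[0,1]$, and let $A(x)=\sin(2\pi x)$. Let $m(A)=\sup_\rho\int A\,d\rho$, the supremum being over the $T$-invariant Borel probability measures $\rho$ on $S^1$; a maximizing probability is an invariant probability attaining this supremum. A calibrated subaction for $A$ is a continuous function $V:S^1\to\mathbb R$ with $V(x)=\max_{T(y)=x}\,[A(y)+V(y)-m(A)]$ for all $x\in S^1$. Then: 1. There is exactly one maximizing probability for $A$, and its support is the periodic orbit $\{1/15,2/15,4/15,8/15\}$ of period $4$. 2. $m(A)=\hat m$, where $\hat m:=\frac14\left(A(1/15)+A(2/15)+A(4/15)+A(8/15)\right)$. 3. For every $x\in[0,1]$ the series $$V_1(x)=\sum_{m=0}^{\infty}\ \sum_{j=0}^{3}\left[\sin\left(\frac{\pi}{2^{j+4m}}\left(\frac{2^{4(m+1)}-1}{2^4-1}+x\right)\right)-\sin\left(2\pi\,\frac{2^{j}}{15}\right)\right]$$ (whose $m$-th term is the inner sum over $j$) converges absolutely. Define recursively, for $j=1,2,3,4$,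 $V_{j+1}(x)=V_j(\tau_1(x))+A(\tau_1(x))-\hat m$. Then also $V_1(x)+\hat m=V_4(\tau_2(x))+A(\tau_2(x))$ for every $x\in[0,1]$. 4. The function $V=\sup\{V_1,V_2,V_3,V_4,V_5\}$ on $[0,1]$ satisfies $V(0)=V(1)$, and, as a function on $S^1$, it is a calibrated subaction for $A$. -/

import Mathlib

open MeasureTheory Set

noncomputable section

/-- The doubling map `T(x) = 2x (mod 1)` of the circle `S¹ = ℝ/ℤ`. -/
def doublingMap (x : UnitAddCircle) : UnitAddCircle := 2 • x

/-- `ρ` is a Borel probability measure on the circle that is invariant under the doubling map. -/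
def IsInvariantProb (ρ : Measure UnitAddCircle) : Prop :=
  IsProbabilityMeasure ρ ∧ MeasurePreserving doublingMap ρ ρ

/-- The maximal ergodic value `m(A)` of a (continuous) potential `A : S¹ → ℝ`: the supremum of
`∫ A dρ` over the `T`-invariant probabilities `ρ`. -/
def maxErgodicValue (A : UnitAddCircle → ℝ) : ℝ :=
  sSup {r : ℝ | ∃ ρ : Measure UnitAddCircle, IsInvariantProb ρ ∧ r = ∫ x, A x ∂ρ}

/-- A maximizing probability for `A`: an invariant probability attaining the supremum `m(A)`. -/
def IsMaximizingProb (A : UnitAddCircle → ℝ) (μ : Measure UnitAddCircle) : Prop :=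
  IsInvariantProb μ ∧ ∫ x, A x ∂μ = maxErgodicValue A

/-- A calibrated subaction for `A`: a continuous `V : S¹ → ℝ` with
`V(x) = max_{T(y) = x} [A(y) + V(y) - m(A)]` for every `x`. -/
def IsCalibratedSubaction (A V : UnitAddCircle → ℝ) : Prop :=
  Continuous V ∧
    ∀ x : UnitAddCircle,
      IsGreatest {r : ℝ | ∃ y : UnitAddCircle,
        doublingMap y = x ∧ r = A y + V y - maxErgodicValue A} (V x)

/-- The potential `x ↦ sin(2πx)` in a real coordinate. -/
def sinPot (x : ℝ) : ℝ := Real.sin (2 * Real.pi * x)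

theorem sinPot_periodic : Function.Periodic sinPot 1 := by
  intro x
  simp only [sinPot, mul_add, mul_one, Real.sin_add_two_pi]

/-- The potential `A(x) = sin(2πx)` as a function on the circle. -/
def sinPotCircle : UnitAddCircle → ℝ := sinPot_periodic.lift

theorem sinPotCircle_coe (x : ℝ) :
    sinPotCircle (x : UnitAddCircle) = Real.sin (2 * Real.pi * x) := rfl

/-- The periodic orbit `{1/15, 2/15, 4/15, 8/15}` of the doubling map. -/
def orbit15 : Set UnitAddCircle :=
  {((1 / 15 : ℝ) : UnitAddCircle), ((2 / 15 : ℝ) : UnitAddCircle),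
    ((4 / 15 : ℝ) : UnitAddCircle), ((8 / 15 : ℝ) : UnitAddCircle)}

/-- The average of `A` over the orbit `{1/15, 2/15, 4/15, 8/15}`. -/
def orbitAverage : ℝ :=
  (sinPot (1 / 15) + sinPot (2 / 15) + sinPot (4 / 15) + sinPot (8 / 15)) / 4

/-- The inverse branch `τ₁(x) = x/2` of the doubling map. -/
def tau1 (x : ℝ) : ℝ := x / 2

/-- The inverse branch `τ₂(x) = (x+1)/2` of the doubling map. -/
def tau2 (x : ℝ) : ℝ := (x + 1) / 2

/-- The `m`-th term (a sum over `j = 0, 1, 2, 3`) of the series that defines `V₁`. -/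
def V1term (x : ℝ) (m : ℕ) : ℝ :=
  ∑ j ∈ Finset.range 4,
    (Real.sin (Real.pi / 2 ^ (j + 4 * m) * ((2 ^ (4 * (m + 1)) - 1) / (2 ^ 4 - 1) + x))
      - Real.sin (2 * Real.pi * (2 ^ j / 15)))

/-- The function `V₁`, given by its series. -/
def V1 (x : ℝ) : ℝ := ∑' m : ℕ, V1term x m

/-- `V₂(x) + m̂ = V₁(τ₁ x) + A(τ₁ x)`, where `m̂` is the average of `A` over the orbit. -/
def V2 (x : ℝ) : ℝ := V1 (tau1 x) + sinPot (tau1 x) - orbitAverage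

/-- `V₃(x) + m̂ = V₂(τ₁ x) + A(τ₁ x)`. -/
def V3 (x : ℝ) : ℝ := V2 (tau1 x) + sinPot (tau1 x) - orbitAverage

/-- `V₄(x) + m̂ = V₃(τ₁ x) + A(τ₁ x)`. -/
def V4 (x : ℝ) : ℝ := V3 (tau1 x) + sinPot (tau1 x) - orbitAverage

/-- `V₅(x) + m̂ = V₄(τ₁ x) + A(τ₁ x)`. -/
def V5 (x : ℝ) : ℝ := V4 (tau1 x) + sinPot (tau1 x) - orbitAverage

/-- `V = sup {V₁, V₂, V₃, V₄, V₅}`. -/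
def Vsup (x : ℝ) : ℝ := V1 x ⊔ V2 x ⊔ V3 x ⊔ V4 x ⊔ V5 x

end

/-! The proof builds a subaction explicitly and reads everything off its defect `R = V ∘ T - V - A +
m̂`. If `R ≥ 0`, integrating against an invariant probability `ρ` gives `∫ R dρ = m̂ - ∫ A dρ`.
Hence no integral exceeds `m̂`, the orbit measure attains it, and a maximizing probability lives on
points whose whole orbit lies in `{R = 0}`.

The inverse branch `x ↦ (x + 1)/16` of `T⁴` contracts to its fixed point 1/15. The series `V₁` sums
`A - m̂` along this branch, so `V₁` is reproduced by one turn of the cycle: `τ₁` sends `V₁, …, V₄`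
to `V₂, …, V₅` and `τ₂` sends `V₄` back to `V₁`. Of the ten transfers of the five functions, only
`V₅` along `τ₁` and `V₁, V₂, V₃, V₅` along `τ₂` remain. Each of them lies strictly below `Vsup`,
which yields both `R ≥ 0` and the calibration (`Vsup_eq_transfer`).

These strict inequalities, and those that locate where `V₁` dominates, are numerical: the functions
are replaced by rational polynomials with proved error bounds, and positivity is certified by
bisection (`exists_evalCoeffs_pos`). They confine `{R = 0}` to the arc `[3/64, 9/16]`. An expansion
argument shows that only the period-four orbit stays there forever (`NoDefect.eq_or`), and
invariance equalizes the four masses. -/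

/-! ### Positivity certificates for rational polynomials on `[-1, 1]` -/

/-- The value at a real number of the polynomial with the given coefficients (constant first). -/
def evalCoeffs : List ℚ → ℝ → ℝ
  | [], _ => 0
  | a :: p, s => a + s * evalCoeffs p s

/-- The coefficients of `c + (d + h s) q(s)`. -/
def mulAffine (h d : ℚ) : ℚ → List ℚ → List ℚ
  | c, [] => [c]
  | c, b :: q => (c + d * b) :: mulAffine h d (h * b) q

/-- The coefficients of `p(d + h s)`. -/
def compAffine (h d : ℚ) : List ℚ → List ℚ
  | [] => []
  | a :: p => mulAffine h d a (compAffine h d p)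

/-- Addition of coefficient lists. -/
def addCoeffs : List ℚ → List ℚ → List ℚ
  | [], q => q
  | p, [] => p
  | a :: p, b :: q => (a + b) :: addCoeffs p q

/-- Subtraction of coefficient lists. -/
def subCoeffs : List ℚ → List ℚ → List ℚ
  | [], q => q.map (fun a => -a)
  | p, [] => p
  | a :: p, b :: q => (a - b) :: subCoeffs p q

/-- The sum of the absolute values of the coefficients. -/
def absSum : List ℚ → ℚ
  | [] => 0
  | a :: p => |a| + absSum p

/-- The constant coefficient exceeds the sum of the absolute values of the others. -/
def isDominant : List ℚ → Bool
  | [] => false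
  | a :: p => decide (absSum p < a)

/-- A bisection search, of the given depth, which certifies that at every point of `[-1, 1]`
at least one of the polynomials is positive. -/
def somePositive : ℕ → List (List ℚ) → Bool
  | 0, _ => false
  | n + 1, ps =>
    ps.any isDominant ||
      (somePositive n (ps.map (compAffine (1 / 2) (-1 / 2))) &&
        somePositive n (ps.map (compAffine (1 / 2) (1 / 2))))

theorem evalCoeffs_mulAffine (h d : ℚ) (q : List ℚ) (c : ℚ) (s : ℝ) :
    evalCoeffs (mulAffine h d c q) s = c + (d + h * s) * evalCoeffs q s := by
  induction q generalizing c with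
  | nil => simp [mulAffine, evalCoeffs]
  | cons b q ih =>
    simp only [mulAffine, evalCoeffs, ih]
    push_cast
    ring

theorem evalCoeffs_compAffine (h d : ℚ) (p : List ℚ) (s : ℝ) :
    evalCoeffs (compAffine h d p) s = evalCoeffs p (d + h * s) := by
  induction p with
  | nil => rfl
  | cons a p ih => simp only [compAffine, evalCoeffs, evalCoeffs_mulAffine, ih]

theorem evalCoeffs_addCoeffs (p q : List ℚ) (s : ℝ) :
    evalCoeffs (addCoeffs p q) s = evalCoeffs p s + evalCoeffs q s := by
  induction p generalizing q with
  | nil => simp [addCoeffs, evalCoeffs]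
  | cons a p ih =>
    cases q with
    | nil => simp [addCoeffs, evalCoeffs]
    | cons b q =>
      simp only [addCoeffs, evalCoeffs, ih]
      push_cast
      ring

theorem evalCoeffs_map_neg (q : List ℚ) (s : ℝ) :
    evalCoeffs (q.map (fun a => -a)) s = -evalCoeffs q s := by
  induction q with
  | nil => simp [evalCoeffs]
  | cons b q ih =>
    simp only [List.map_cons, evalCoeffs, ih]
    push_cast
    ring

theorem evalCoeffs_subCoeffs (p q : List ℚ) (s : ℝ) :
    evalCoeffs (subCoeffs p q) s = evalCoeffs p s - evalCoeffs q s := by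
  induction p generalizing q with
  | nil => simp only [subCoeffs, evalCoeffs_map_neg, evalCoeffs]; ring
  | cons a p ih =>
    cases q with
    | nil => simp [subCoeffs, evalCoeffs]
    | cons b q =>
      simp only [subCoeffs, evalCoeffs, ih]
      push_cast
      ring

theorem abs_evalCoeffs_le (p : List ℚ) {s : ℝ} (hs : |s| ≤ 1) :
    |evalCoeffs p s| ≤ absSum p := by
  induction p with
  | nil => simp [evalCoeffs, absSum]
  | cons a p ih =>
    simp only [evalCoeffs, absSum]
    push_cast
    refine (abs_add_le _ _).trans (add_le_add le_rfl ?_)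
    rw [abs_mul]
    exact (mul_le_of_le_one_left (abs_nonneg _) hs).trans ih

theorem evalCoeffs_pos_of_isDominant {p : List ℚ} (hp : isDominant p = true) {s : ℝ}
    (hs : |s| ≤ 1) : 0 < evalCoeffs p s := by
  cases p with
  | nil => simp [isDominant] at hp
  | cons a p =>
    have h1 : ((absSum p : ℚ) : ℝ) < a := by
      simpa [isDominant] using hp
    have h2 := abs_evalCoeffs_le p hs
    have h3 : |s * evalCoeffs p s| ≤ absSum p := by
      rw [abs_mul]
      exact (mul_le_of_le_one_left (abs_nonneg _) hs).trans h2
    have h4 := neg_abs_le (s * evalCoeffs p s)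
    simp only [evalCoeffs]
    linarith

/-- Each half of `[-1, 1]` is rescaled to `[-1, 1]`. Different polynomials may be positive on
different pieces, which is exactly what a strict lower bound for a supremum requires. -/
theorem exists_evalCoeffs_pos {n : ℕ} {ps : List (List ℚ)} (h : somePositive n ps = true)
    {s : ℝ} (hs : |s| ≤ 1) : ∃ p ∈ ps, 0 < evalCoeffs p s := by
  induction n generalizing ps s with
  | zero => simp [somePositive] at h
  | succ n ih =>
    simp only [somePositive, Bool.or_eq_true, Bool.and_eq_true, List.any_eq_true] at h
    have hs' := abs_le.1 hs
    rcases h with ⟨p, hp, hd⟩ | ⟨h1, h2⟩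
    · exact ⟨p, hp, evalCoeffs_pos_of_isDominant hd hs⟩
    · rcases le_total s 0 with h0 | h0
      · obtain ⟨p, hp, hpos⟩ := ih h1 (s := 2 * s + 1) (abs_le.2 ⟨by linarith, by linarith⟩)
        obtain ⟨q, hq, rfl⟩ := List.mem_map.1 hp
        refine ⟨q, hq, ?_⟩
        rw [evalCoeffs_compAffine] at hpos
        convert hpos using 2
        push_cast
        ring
      · obtain ⟨p, hp, hpos⟩ := ih h2 (s := 2 * s - 1) (abs_le.2 ⟨by linarith, by linarith⟩)
        obtain ⟨q, hq, rfl⟩ := List.mem_map.1 hp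
        refine ⟨q, hq, ?_⟩
        rw [evalCoeffs_compAffine] at hpos
        convert hpos using 2
        push_cast
        ring

/-! ### A polynomial approximation of the potential -/

theorem abs_sin_sub_sin_le (a b : ℝ) : |Real.sin a - Real.sin b| ≤ |a - b| := by
  have := Convex.norm_image_sub_le_of_norm_deriv_le (f := Real.sin) (C := 1) (s := univ)
    (x := b) (y := a) (fun x _ => Real.differentiable_sin x)
    (fun x _ => by simpa using Real.abs_cos_le_one x) convex_univ (mem_univ _) (mem_univ _)
  simpa using this

/-- Imaginary part of the 15-term exponential bound at `i x`. That bound needs `|x| / 16 ≤ 1/2`,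
whence the 8, and it allows twice the first omitted term. -/
theorem abs_sin_sub_taylor_le {x : ℝ} (hx : |x| ≤ 8) :
    |Real.sin x - (x - x ^ 3 / 6 + x ^ 5 / 120 - x ^ 7 / 5040 + x ^ 9 / 362880
      - x ^ 11 / 39916800 + x ^ 13 / 6227020800)| ≤ |x| ^ 15 / 1307674368000 * 2 := by
  have h := Complex.exp_bound' (x := (x : ℂ) * Complex.I) (n := 15) (by
    simp only [norm_mul, Complex.norm_real, Complex.norm_I, Real.norm_eq_abs]
    norm_num
    linarith)
  have h2 := (Complex.abs_im_le_norm _).trans h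
  simp only [Finset.sum_range_succ, Finset.sum_range_zero, Complex.sub_im,
    Complex.exp_ofReal_mul_I_im, norm_mul, Complex.norm_real, Complex.norm_I,
    Real.norm_eq_abs, mul_one] at h2
  refine le_trans (le_of_eq ?_) (h2.trans (le_of_eq ?_))
  · congr 2
    have e : ∀ k : ℕ, ((x : ℂ) * Complex.I) ^ k / (k.factorial : ℂ)
        = ((x ^ k / k.factorial : ℝ) : ℂ) * Complex.I ^ k := by
      intro k; push_cast; ring
    have hI3 : Complex.I ^ 3 = -Complex.I := Complex.I_pow_three
    have hI4 : Complex.I ^ 4 = 1 := Complex.I_pow_four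
    simp only [e]
    rw [show Complex.I ^ 5 = Complex.I by rw [show 5 = 4 + 1 from rfl, pow_add, hI4]; simp,
      show Complex.I ^ 6 = -1 by rw [show 6 = 4 + 2 from rfl, pow_add, hI4]; simp,
      show Complex.I ^ 7 = -Complex.I by rw [show 7 = 4 + 3 from rfl, pow_add, hI4, hI3]; simp,
      show Complex.I ^ 8 = 1 by rw [show 8 = 4 * 2 from rfl, pow_mul, hI4]; simp,
      show Complex.I ^ 9 = Complex.I by
        rw [show 9 = 4 * 2 + 1 from rfl, pow_add, pow_mul, hI4]; simp,
      show Complex.I ^ 10 = -1 by rw [show 10 = 4 * 2 + 2 from rfl, pow_add, pow_mul, hI4]; simp,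
      show Complex.I ^ 11 = -Complex.I by
        rw [show 11 = 4 * 2 + 3 from rfl, pow_add, pow_mul, hI4, hI3]; simp,
      show Complex.I ^ 12 = 1 by rw [show 12 = 4 * 3 from rfl, pow_mul, hI4]; simp,
      show Complex.I ^ 13 = Complex.I by
        rw [show 13 = 4 * 3 + 1 from rfl, pow_add, pow_mul, hI4]; simp,
      show Complex.I ^ 14 = -1 by rw [show 14 = 4 * 3 + 2 from rfl, pow_add, pow_mul, hI4]; simp,
      hI3, hI4, Complex.I_sq, pow_one, pow_zero]
    simp only [Complex.add_im, Complex.im_ofReal_mul, Complex.neg_im,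
      Complex.I_im, Complex.one_im]
    norm_num [Nat.factorial]
    ring
  · norm_num [Nat.factorial]

/-- The coefficients, in `s ∈ [-1, 1]`, of a polynomial approximation of `A((s + 1) / 2)`. -/
def sinCoeffs : List ℚ :=
  let q : ℚ := 3217 / 1024
  [0, -q, 0, q ^ 3 / 6, 0, -q ^ 5 / 120, 0, q ^ 7 / 5040, 0, -q ^ 9 / 362880, 0,
    q ^ 11 / 39916800, 0, -q ^ 13 / 6227020800]

theorem abs_sinPot_sub_le {s : ℝ} (hs : |s| ≤ 1) :
    |sinPot ((s + 1) / 2) - evalCoeffs sinCoeffs s| ≤ 6 / 100000 := by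
  have e1 : sinPot ((s + 1) / 2) = -Real.sin (Real.pi * s) := by
    rw [sinPot, ← Real.sin_add_pi]
    congr 1
    ring
  -- 3217/1024 is a rational stand-in for π, off by less than 10⁻⁵; the Taylor remainder costs at
  -- most 5·10⁻⁵ more.
  set z : ℝ := 3217 / 1024 * s with hz
  have hz1 : |z| ≤ 3217 / 1024 := by
    rw [hz, abs_mul, abs_of_pos (by norm_num : (0 : ℝ) < 3217 / 1024)]
    linarith
  have e2 : evalCoeffs sinCoeffs s = -(z - z ^ 3 / 6 + z ^ 5 / 120 - z ^ 7 / 5040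
      + z ^ 9 / 362880 - z ^ 11 / 39916800 + z ^ 13 / 6227020800) := by
    simp only [sinCoeffs, evalCoeffs, hz]
    push_cast
    ring
  have h1 := abs_sin_sub_taylor_le (x := z) (by linarith)
  have h2 : |z| ^ 15 ≤ (3217 / 1024) ^ 15 := pow_le_pow_left₀ (abs_nonneg _) hz1 15
  have h3 : |Real.sin (Real.pi * s) - Real.sin z| ≤ 1 / 100000 := by
    refine (abs_sin_sub_sin_le _ _).trans ?_
    rw [hz, ← sub_mul, abs_mul]
    have : |Real.pi - 3217 / 1024| ≤ 1 / 100000 := by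
      rw [abs_le]
      constructor <;> linarith [Real.pi_gt_d6, Real.pi_lt_d6]
    nlinarith [abs_nonneg s, abs_nonneg (Real.pi - 3217 / 1024)]
  rw [e1, e2]
  have h4 : |z| ^ 15 / 1307674368000 * 2 ≤ 5 / 100000 := by
    have : (3217 / 1024 : ℝ) ^ 15 / 1307674368000 * 2 ≤ 5 / 100000 := by norm_num
    linarith
  have h5 := h1.trans h4
  rw [abs_le] at h3 h5 ⊢
  constructor <;> linarith [h3.1, h3.2, h5.1, h5.2]

theorem abs_orbitAverage_sub_le : |orbitAverage - 48412 / 100000| ≤ 8 / 100000 := by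
  have key : ∀ k : ℝ, |2 * k - 1| ≤ 1 →
      |sinPot k - evalCoeffs sinCoeffs (2 * k - 1)| ≤ 6 / 100000 := by
    intro k hk
    have := abs_sinPot_sub_le hk
    rwa [show (2 * k - 1 + 1) / 2 = k by ring] at this
  have h1 := abs_le.1 (key (1 / 15) (by norm_num [abs_le]))
  have h2 := abs_le.1 (key (2 / 15) (by norm_num [abs_le]))
  have h4 := abs_le.1 (key (4 / 15) (by norm_num [abs_le]))
  have h8 := abs_le.1 (key (8 / 15) (by norm_num [abs_le]))
  simp only [sinCoeffs, evalCoeffs] at h1 h2 h4 h8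
  norm_num at h1 h2 h4 h8
  rw [orbitAverage, abs_le]
  constructor <;> linarith [h1.1, h1.2, h2.1, h2.2, h4.1, h4.2, h8.1, h8.2]

/-! ### The series `V₁` -/

/-- Sine is 1-Lipschitz and the four frequencies sum to `π (15/8) 16⁻ᵐ`. Written this way, the sum
over `m` is exactly `2π`. -/
theorem V1term_abs_sub_le (x y : ℝ) (m : ℕ) :
    |V1term x m - V1term y m| ≤ 15 / 16 * Real.pi * 2 * |x - y| * (1 / 16) ^ m := by
  have hj : ∀ j : ℕ, |(Real.sin (Real.pi / 2 ^ (j + 4 * m)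
        * ((2 ^ (4 * (m + 1)) - 1) / (2 ^ 4 - 1) + x)) - Real.sin (2 * Real.pi * (2 ^ j / 15)))
      - (Real.sin (Real.pi / 2 ^ (j + 4 * m)
        * ((2 ^ (4 * (m + 1)) - 1) / (2 ^ 4 - 1) + y)) - Real.sin (2 * Real.pi * (2 ^ j / 15)))|
      ≤ Real.pi * |x - y| * (1 / 16) ^ m * (1 / 2) ^ j := by
    intro j
    rw [sub_sub_sub_cancel_right]
    refine (abs_sin_sub_sin_le _ _).trans (le_of_eq ?_)
    rw [← mul_sub, add_sub_add_left_eq_sub, abs_mul, abs_of_pos (by positivity), pow_add, pow_mul,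
      one_div_pow, one_div_pow]
    norm_num
    field_simp
  rw [V1term, V1term, ← Finset.sum_sub_distrib]
  refine (Finset.abs_sum_le_sum_abs _ _).trans ((Finset.sum_le_sum fun j _ => hj j).trans ?_)
  rw [← Finset.mul_sum]
  simp only [Finset.sum_range_succ, Finset.sum_range_zero]
  apply le_of_eq
  ring

/-- At the fixed point the preimages run through the periodic orbit in reverse, so the sines cancel
in the sum over `j`, not term by term. With the Lipschitz bound this gives geometric decay at every
point. -/
theorem V1term_one_div_fifteen (m : ℕ) : V1term (1 / 15) m = 0 := by
  have e : ∀ j ∈ Finset.range 4, Real.sin (Real.pi / 2 ^ (j + 4 * m)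
      * ((2 ^ (4 * (m + 1)) - 1) / (2 ^ 4 - 1) + 1 / 15))
      = Real.sin (2 * Real.pi * (2 ^ (3 - j) / 15)) := by
    intro j hj
    have hj' : j < 4 := Finset.mem_range.1 hj
    congr 1
    have : (2 : ℝ) ^ (4 * (m + 1)) = 2 ^ (j + 4 * m) * (2 ^ (3 - j) * 2) := by
      rw [← pow_succ, ← pow_add]
      congr 1
      omega
    rw [this]
    field_simp
    ring
  rw [V1term, Finset.sum_sub_distrib, Finset.sum_congr rfl e]
  simp only [Finset.sum_range_succ, Finset.sum_range_zero]
  norm_num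
  ring

theorem V1term_abs_le (x : ℝ) (m : ℕ) :
    |V1term x m| ≤ 15 / 16 * Real.pi * 2 * |x - 1 / 15| * (1 / 16) ^ m := by
  have := V1term_abs_sub_le x (1 / 15) m
  rwa [V1term_one_div_fifteen, sub_zero] at this

theorem summable_V1term (x : ℝ) : Summable (V1term x) :=
  Summable.of_norm_bounded
    ((summable_geometric_of_lt_one (by norm_num) (by norm_num)).mul_left _) (V1term_abs_le x)

theorem V1_abs_sub_le (x y : ℝ) : |V1 x - V1 y| ≤ 2 * Real.pi * |x - y| := by
  rw [V1, V1, ← (summable_V1term x).tsum_sub (summable_V1term y)]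
  have hg : HasSum (fun m : ℕ => 15 / 16 * Real.pi * 2 * |x - y| * (1 / 16 : ℝ) ^ m)
      (15 / 16 * Real.pi * 2 * |x - y| * (1 - 1 / 16)⁻¹) :=
    (hasSum_geometric_of_lt_one (by norm_num) (by norm_num)).mul_left _
  refine (tsum_of_norm_bounded (f := fun m => V1term x m - V1term y m) hg
    (V1term_abs_sub_le x y)).trans (le_of_eq ?_)
  norm_num
  ring

theorem V1_one_div_fifteen : V1 (1 / 15) = 0 := by
  simp only [V1, V1term_one_div_fifteen, tsum_zero]

theorem V1_abs_le (x : ℝ) : |V1 x| ≤ 2 * Real.pi * |x - 1 / 15| := by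
  have := V1_abs_sub_le x (1 / 15)
  rwa [V1_one_div_fifteen, sub_zero] at this

theorem continuous_V1 : Continuous V1 := by
  refine (LipschitzWith.of_dist_le_mul (K := ⟨2 * Real.pi, by positivity⟩) ?_).continuous
  intro x y
  exact V1_abs_sub_le x y

theorem continuous_sinPot : Continuous sinPot := by
  unfold sinPot
  fun_prop

/-- Shifting the index by one amounts to applying the contracting branch `x ↦ (x + 1)/16`; this
makes `V1` a fixed point of `transferCycle`. -/
theorem V1term_succ (x : ℝ) (m : ℕ) : V1term x (m + 1) = V1term ((x + 1) / 16) m := by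
  refine Finset.sum_congr rfl fun j _ => ?_
  congr 2
  have h1 : (2 : ℝ) ^ (j + 4 * (m + 1)) = 2 ^ (j + 4 * m) * 16 := by
    rw [show j + 4 * (m + 1) = j + 4 * m + 4 by ring, pow_add]
    norm_num
  have h2 : (2 : ℝ) ^ (4 * (m + 1 + 1)) = 2 ^ (4 * (m + 1)) * 16 := by
    rw [show 4 * (m + 1 + 1) = 4 * (m + 1) + 4 by ring, pow_add]
    norm_num
  rw [h1, h2]
  field_simp
  ring

theorem V1_eq_add (x : ℝ) : V1 x = V1term x 0 + V1 ((x + 1) / 16) := by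
  rw [V1, (summable_V1term x).tsum_eq_zero_add, V1]
  simp only [V1term_succ]

/-! ### The transfer of functions along the inverse branches -/

/-- `f(τ(x)) + A(τ(x)) - m̂` for an inverse branch `τ`. -/
noncomputable def transfer (τ f : ℝ → ℝ) (x : ℝ) : ℝ := f (τ x) + sinPot (τ x) - orbitAverage

/-- Transfer along the branches of the backward orbit of period four. -/
noncomputable def transferCycle (f : ℝ → ℝ) : ℝ → ℝ :=
  transfer tau2 (transfer tau1 (transfer tau1 (transfer tau1 f)))

theorem V5_eq : V5 = transfer tau1 V4 := rfl

theorem transferCycle_apply (f : ℝ → ℝ) (x : ℝ) :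
    transferCycle f x = V1term x 0 + f ((x + 1) / 16) := by
  simp only [transferCycle, transfer, tau1, tau2, V1term, orbitAverage, sinPot,
    Finset.sum_range_succ, Finset.sum_range_zero]
  rw [show 2 * Real.pi * ((x + 1) / 2) = Real.pi / 2 ^ (0 + 4 * 0)
      * ((2 ^ (4 * (0 + 1)) - 1) / (2 ^ 4 - 1) + x) by ring,
    show 2 * Real.pi * ((x + 1) / 2 / 2) = Real.pi / 2 ^ (1 + 4 * 0)
      * ((2 ^ (4 * (0 + 1)) - 1) / (2 ^ 4 - 1) + x) by ring,
    show 2 * Real.pi * ((x + 1) / 2 / 2 / 2) = Real.pi / 2 ^ (2 + 4 * 0)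
      * ((2 ^ (4 * (0 + 1)) - 1) / (2 ^ 4 - 1) + x) by ring,
    show 2 * Real.pi * ((x + 1) / 2 / 2 / 2 / 2) = Real.pi / 2 ^ (3 + 4 * 0)
      * ((2 ^ (4 * (0 + 1)) - 1) / (2 ^ 4 - 1) + x) by ring,
    show (x + 1) / 2 / 2 / 2 / 2 = (x + 1) / 16 by ring]
  norm_num
  ring

theorem transferCycle_V1 : transferCycle V1 = V1 := by
  funext x
  rw [transferCycle_apply, ← V1_eq_add]

theorem V1_eq_transfer_V4 : V1 = transfer tau2 V4 := transferCycle_V1.symm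

theorem V1_add_orbitAverage (x : ℝ) :
    V1 x + orbitAverage = V4 (tau2 x) + sinPot (tau2 x) := by
  rw [V1_eq_transfer_V4, transfer]
  ring

theorem continuous_transfer {τ f : ℝ → ℝ} (hτ : Continuous τ) (hf : Continuous f) :
    Continuous (transfer τ f) :=
  ((hf.comp hτ).add (continuous_sinPot.comp hτ)).sub continuous_const

theorem continuous_tau1 : Continuous tau1 := by unfold tau1; fun_prop

theorem continuous_Vsup : Continuous Vsup := by
  have h2 := continuous_transfer continuous_tau1 continuous_V1
  have h3 := continuous_transfer continuous_tau1 h2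
  have h4 := continuous_transfer continuous_tau1 h3
  have h5 := continuous_transfer continuous_tau1 h4
  exact (((continuous_V1.max h2).max h3).max h4).max h5

/-! ### Polynomial approximations of `V₁, …, V₅` and of their transfers -/

/-- `p` approximates `f` on `[0, 1]`, in the coordinate `s = 2x - 1`, up to `e`. -/
def Approximates (f : ℝ → ℝ) (p : List ℚ) (e : ℝ) : Prop :=
  ∀ s : ℝ, |s| ≤ 1 → |f ((s + 1) / 2) - evalCoeffs p s| ≤ e

/-- The approximation of `transfer tau1`. -/
def transferCoeffs1 (p : List ℚ) : List ℚ :=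
  compAffine (1 / 2) (-1 / 2) (addCoeffs (addCoeffs [-48412 / 100000] sinCoeffs) p)

/-- The approximation of `transfer tau2`. -/
def transferCoeffs2 (p : List ℚ) : List ℚ :=
  compAffine (1 / 2) (1 / 2) (addCoeffs (addCoeffs [-48412 / 100000] sinCoeffs) p)

/-- The added error is 6·10⁻⁵ from the potential and 8·10⁻⁵ from the average. -/
theorem abs_transfer_sub_le {τ f : ℝ → ℝ} {p : List ℚ} {e : ℝ} (h : Approximates f p e)
    {x t : ℝ} (hx : τ x = (t + 1) / 2) (ht : |t| ≤ 1) :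
    |transfer τ f x - evalCoeffs (addCoeffs (addCoeffs [-48412 / 100000] sinCoeffs) p) t|
      ≤ e + 2 / 10000 := by
  have h1 := abs_le.1 (h t ht)
  have h2 := abs_le.1 (abs_sinPot_sub_le ht)
  have h3 := abs_le.1 abs_orbitAverage_sub_le
  rw [evalCoeffs_addCoeffs, evalCoeffs_addCoeffs, transfer, hx]
  simp only [evalCoeffs]
  push_cast
  rw [abs_le]
  constructor <;> linarith [h1.1, h1.2, h2.1, h2.2, h3.1, h3.2]

theorem Approximates.transfer_tau1 {f : ℝ → ℝ} {p : List ℚ} {e : ℝ} (h : Approximates f p e) :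
    Approximates (transfer tau1 f) (transferCoeffs1 p) (e + 2 / 10000) := by
  intro s hs
  have hs' := abs_le.1 hs
  rw [transferCoeffs1, evalCoeffs_compAffine]
  refine abs_transfer_sub_le h ?_ ?_
  · rw [tau1]; push_cast; ring
  · push_cast
    rw [abs_le]
    constructor <;> linarith [hs'.1, hs'.2]

theorem Approximates.transfer_tau2 {f : ℝ → ℝ} {p : List ℚ} {e : ℝ} (h : Approximates f p e) :
    Approximates (transfer tau2 f) (transferCoeffs2 p) (e + 2 / 10000) := by
  intro s hs
  have hs' := abs_le.1 hs
  rw [transferCoeffs2, evalCoeffs_compAffine]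
  refine abs_transfer_sub_le h ?_ ?_
  · rw [tau2]; push_cast; ring
  · push_cast
    rw [abs_le]
    constructor <;> linarith [hs'.1, hs'.2]

/-- The approximation of `transferCycle`. -/
def cycleCoeffs (p : List ℚ) : List ℚ :=
  transferCoeffs2 (transferCoeffs1 (transferCoeffs1 (transferCoeffs1 p)))

theorem Approximates.transferCycle {f : ℝ → ℝ} {p : List ℚ} {e : ℝ} (h : Approximates f p e) :
    Approximates (transferCycle f) (cycleCoeffs p) (e + 8 / 10000) := by
  intro s hs
  refine (h.transfer_tau1.transfer_tau1.transfer_tau1.transfer_tau2 s hs).trans (le_of_eq ?_)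
  ring

/-- Allows rounding and truncating coefficients after each transfer, so that the later exact
computations stay small. -/
theorem Approximates.of_absSum_subCoeffs_le {f : ℝ → ℝ} {p q : List ℚ} {e : ℝ}
    (h : Approximates f p e) (hpq : decide (absSum (subCoeffs p q) ≤ 1 / 10000) = true) :
    Approximates f q (e + 1 / 10000) := by
  intro s hs
  have h1 := abs_le.1 (h s hs)
  have h2 : ((absSum (subCoeffs p q) : ℚ) : ℝ) ≤ ((1 / 10000 : ℚ) : ℝ) :=
    Rat.cast_le.2 (of_decide_eq_true hpq)
  have h3 := abs_le.1 ((abs_evalCoeffs_le (subCoeffs p q) hs).trans h2)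
  rw [evalCoeffs_subCoeffs] at h3
  push_cast at h3
  rw [abs_le]
  constructor <;> linarith [h1.1, h1.2, h3.1, h3.2]

/-- Coefficients given in units of `10⁻⁵`. -/
def scaledCoeffs (p : List ℤ) : List ℚ := p.map fun a => a / 100000

/-- The approximations of `V₁, …, V₅`. -/
def vCoeffs : ℕ → List ℚ
  | 0 => scaledCoeffs [-81787, -32037, 93362, 5233, -24151, -173, 2063, 2, -92, 0, 2]
  | 1 => scaledCoeffs [7034, -54916, -110522, 6013, 24343, -179, -2063, 2, 92, 0, -2]
  | 2 => scaledCoeffs [59193, 24136, -144546, -4765, 26457, 168, -2109, -3, 93, 0, -2]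
  | 3 => scaledCoeffs [64788, 76161, -148335, -6520, 26526, 182, -2109, -3, 93, 0, -2]
  | _ => scaledCoeffs [43646, 103396, -148603, -6752, 26528, 183, -2109, -3, 93, 0, -2]

/-- Three turns of the cycle applied to 0 differ from `V1` by the value of `V1` at a point within
`16⁻³` of its zero 1/15, at most `2π/4096`. -/
theorem approximates_V1 : Approximates V1 (vCoeffs 0) (5 / 1000) := by
  have h0 : Approximates (fun _ => 0) [] 0 := by
    intro s _
    simp [evalCoeffs]
  have h := h0.transferCycle.transferCycle.transferCycle.of_absSum_subCoeffs_le
    (q := vCoeffs 0) (by decide +kernel)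
  intro s hs
  have h1 := abs_le.1 (h s hs)
  set x : ℝ := (s + 1) / 2 with hx
  have h2 : V1 x - _root_.transferCycle (_root_.transferCycle (_root_.transferCycle fun _ => 0)) x
      = V1 ((((x + 1) / 16 + 1) / 16 + 1) / 16) := by
    simp only [transferCycle_apply]
    rw [V1_eq_add x, V1_eq_add ((x + 1) / 16), V1_eq_add (((x + 1) / 16 + 1) / 16)]
    ring
  have h3 : |V1 ((((x + 1) / 16 + 1) / 16 + 1) / 16)| ≤ 16 / 10000 := by
    refine (V1_abs_le _).trans ?_
    have : |(((x + 1) / 16 + 1) / 16 + 1) / 16 - 1 / 15| ≤ 1 / 4096 := by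
      have hs' := abs_le.1 hs
      rw [abs_le, hx]
      constructor <;> linarith [hs'.1, hs'.2]
    nlinarith [Real.pi_lt_d6, Real.pi_pos]
  rw [← h2] at h3
  have h4 := abs_le.1 h3
  rw [abs_le]
  constructor <;> linarith [h1.1, h1.2, h4.1, h4.2]

theorem approximates_V2 : Approximates V2 (vCoeffs 1) (6 / 1000) := by
  have h := approximates_V1.transfer_tau1.of_absSum_subCoeffs_le (q := vCoeffs 1)
    (by decide +kernel)
  exact fun s hs => (h s hs).trans (by norm_num)

theorem approximates_V3 : Approximates V3 (vCoeffs 2) (7 / 1000) := by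
  have h := approximates_V2.transfer_tau1.of_absSum_subCoeffs_le (q := vCoeffs 2)
    (by decide +kernel)
  exact fun s hs => (h s hs).trans (by norm_num)

theorem approximates_V4 : Approximates V4 (vCoeffs 3) (8 / 1000) := by
  have h := approximates_V3.transfer_tau1.of_absSum_subCoeffs_le (q := vCoeffs 3)
    (by decide +kernel)
  exact fun s hs => (h s hs).trans (by norm_num)

theorem approximates_V5 : Approximates V5 (vCoeffs 4) (9 / 1000) := by
  have h := approximates_V4.transfer_tau1.of_absSum_subCoeffs_le (q := vCoeffs 4)
    (by decide +kernel)
  exact fun s hs => (h s hs).trans (by norm_num)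

/-- The coefficients of `p - q - 1/50`. -/
def gapCoeffs (p q : List ℚ) : List ℚ := addCoeffs [-1 / 50] (subCoeffs p q)

theorem Approximates.lt_of_gapCoeffs {f g : ℝ → ℝ} {p q : List ℚ} {a b : ℝ}
    (hf : Approximates f p a) (hg : Approximates g q b) {s : ℝ} (hs : |s| ≤ 1)
    (h : 0 < evalCoeffs (gapCoeffs p q) s) (hab : a + b ≤ 1 / 50) :
    g ((s + 1) / 2) < f ((s + 1) / 2) := by
  have h1 := abs_le.1 (hf s hs)
  have h2 := abs_le.1 (hg s hs)
  rw [gapCoeffs, evalCoeffs_addCoeffs, evalCoeffs_subCoeffs] at h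
  simp only [evalCoeffs] at h
  push_cast at h
  linarith [h1.1, h2.2]

/-- The margin 1/50 in `gapCoeffs` absorbs two approximation errors of at most 1/100 each. -/
theorem lt_Vsup_of_somePositive {n : ℕ} {g : ℝ → ℝ} {q : List ℚ} {b : ℝ}
    (hg : Approximates g q b) (hb : b ≤ 1 / 100)
    (h : somePositive n ((List.range 5).map fun i => gapCoeffs (vCoeffs i) q) = true)
    {x : ℝ} (hx : x ∈ Icc (0 : ℝ) 1) : g x < Vsup x := by
  have hs : |2 * x - 1| ≤ 1 := abs_le.2 ⟨by linarith [hx.1], by linarith [hx.2]⟩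
  have e : (2 * x - 1 + 1) / 2 = x := by ring
  obtain ⟨p, hp, hpos⟩ := exists_evalCoeffs_pos h hs
  obtain ⟨i, hi, rfl⟩ := List.mem_map.1 hp
  have hi : i < 5 := List.mem_range.1 hi
  simp only [Vsup, lt_sup_iff]
  interval_cases i
  · have := approximates_V1.lt_of_gapCoeffs hg hs hpos (by linarith)
    rw [e] at this; tauto
  · have := approximates_V2.lt_of_gapCoeffs hg hs hpos (by linarith)
    rw [e] at this; tauto
  · have := approximates_V3.lt_of_gapCoeffs hg hs hpos (by linarith)
    rw [e] at this; tauto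
  · have := approximates_V4.lt_of_gapCoeffs hg hs hpos (by linarith)
    rw [e] at this; tauto
  · have := approximates_V5.lt_of_gapCoeffs hg hs hpos (by linarith)
    rw [e] at this; tauto

/-- This and the next four bounds treat the transfers that are not themselves among `V1`, …, `V5`.
-/
theorem transfer_tau1_V5_lt {x : ℝ} (hx : x ∈ Icc (0 : ℝ) 1) : transfer tau1 V5 x < Vsup x :=
  lt_Vsup_of_somePositive approximates_V5.transfer_tau1 (by norm_num)
    (n := 8) (by decide +kernel) hx

theorem transfer_tau2_V1_lt {x : ℝ} (hx : x ∈ Icc (0 : ℝ) 1) : transfer tau2 V1 x < Vsup x :=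
  lt_Vsup_of_somePositive approximates_V1.transfer_tau2 (by norm_num)
    (n := 8) (by decide +kernel) hx

theorem transfer_tau2_V2_lt {x : ℝ} (hx : x ∈ Icc (0 : ℝ) 1) : transfer tau2 V2 x < Vsup x :=
  lt_Vsup_of_somePositive approximates_V2.transfer_tau2 (by norm_num)
    (n := 8) (by decide +kernel) hx

theorem transfer_tau2_V3_lt {x : ℝ} (hx : x ∈ Icc (0 : ℝ) 1) : transfer tau2 V3 x < Vsup x :=
  lt_Vsup_of_somePositive approximates_V3.transfer_tau2 (by norm_num)
    (n := 8) (by decide +kernel) hx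

theorem transfer_tau2_V5_lt {x : ℝ} (hx : x ∈ Icc (0 : ℝ) 1) : transfer tau2 V5 x < Vsup x :=
  lt_Vsup_of_somePositive approximates_V5.transfer_tau2 (by norm_num)
    (n := 8) (by decide +kernel) hx

/-- The affine polynomial `c + d s` is a decoy: positive outside the region of interest, it excuses
the comparison there and localizes the certificate. -/
theorem lt_of_somePositive_pair {n : ℕ} {f g : ℝ → ℝ} {p q : List ℚ} {a b : ℝ} {c d : ℚ}
    (hf : Approximates f p a) (hg : Approximates g q b) (hab : a + b ≤ 1 / 50)
    (h : somePositive n [gapCoeffs p q, [c, d]] = true)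
    {x : ℝ} (hx : x ∈ Icc (0 : ℝ) 1) (hcd : c + (2 * x - 1) * d ≤ 0) : g x < f x := by
  have hs : |2 * x - 1| ≤ 1 := abs_le.2 ⟨by linarith [hx.1], by linarith [hx.2]⟩
  have e : (2 * x - 1 + 1) / 2 = x := by ring
  obtain ⟨r, hr, hpos⟩ := exists_evalCoeffs_pos h hs
  simp only [List.mem_cons, List.not_mem_nil, or_false] at hr
  rcases hr with rfl | rfl
  · have := hf.lt_of_gapCoeffs hg hs hpos hab
    rwa [e] at this
  · simp only [evalCoeffs, mul_zero, add_zero] at hpos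
    linarith

theorem lt_V1_of_le {x : ℝ} (h0 : 0 ≤ x) (hx : x ≤ 3 / 32) :
    V2 x < V1 x ∧ V3 x < V1 x ∧ V4 x < V1 x ∧ V5 x < V1 x := by
  have hx' : x ∈ Icc (0 : ℝ) 1 := ⟨h0, by linarith⟩
  -- The affine form equals `x - 3/32`.
  have hcd : ((13 / 32 : ℚ) : ℝ) + (2 * x - 1) * ((1 / 2 : ℚ) : ℝ) ≤ 0 := by
    push_cast; linarith
  refine ⟨?_, ?_, ?_, ?_⟩
  · exact lt_of_somePositive_pair (n := 8) approximates_V1 approximates_V2 (by norm_num)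
      (by decide +kernel) hx' hcd
  · exact lt_of_somePositive_pair (n := 8) approximates_V1 approximates_V3 (by norm_num)
      (by decide +kernel) hx' hcd
  · exact lt_of_somePositive_pair (n := 8) approximates_V1 approximates_V4 (by norm_num)
      (by decide +kernel) hx' hcd
  · exact lt_of_somePositive_pair (n := 8) approximates_V1 approximates_V5 (by norm_num)
      (by decide +kernel) hx' hcd

theorem le_V5_one : V2 1 ≤ V5 1 ∧ V3 1 ≤ V5 1 ∧ V4 1 ≤ V5 1 := by
  have hx' : (1 : ℝ) ∈ Icc (0 : ℝ) 1 := ⟨by norm_num, le_rfl⟩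
  -- The affine form is `31/32 - x`, so the comparison is certified on `[31/32, 1]`.
  have hcd : ((15 / 32 : ℚ) : ℝ) + (2 * 1 - 1) * ((-1 / 2 : ℚ) : ℝ) ≤ 0 := by
    push_cast; norm_num
  refine ⟨le_of_lt ?_, le_of_lt ?_, le_of_lt ?_⟩
  · exact lt_of_somePositive_pair (n := 8) approximates_V5 approximates_V2 (by norm_num)
      (by decide +kernel) hx' hcd
  · exact lt_of_somePositive_pair (n := 8) approximates_V5 approximates_V3 (by norm_num)
      (by decide +kernel) hx' hcd
  · exact lt_of_somePositive_pair (n := 8) approximates_V5 approximates_V4 (by norm_num)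
      (by decide +kernel) hx' hcd

theorem V1_lt_Vsup_of_le {x : ℝ} (hx : 1 / 8 ≤ x) (h1 : x ≤ 1) : V1 x < Vsup x := by
  have hs : |2 * x - 1| ≤ 1 := abs_le.2 ⟨by linarith, by linarith⟩
  have e : (2 * x - 1 + 1) / 2 = x := by ring
  -- The last polynomial is `1/8 - x`, which is not positive on the range considered.
  have hc : somePositive 9 [gapCoeffs (vCoeffs 1) (vCoeffs 0), gapCoeffs (vCoeffs 2) (vCoeffs 0),
      gapCoeffs (vCoeffs 3) (vCoeffs 0), gapCoeffs (vCoeffs 4) (vCoeffs 0),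
      [-3 / 8, -1 / 2]] = true := by decide +kernel
  obtain ⟨p, hp, hpos⟩ := exists_evalCoeffs_pos hc hs
  simp only [List.mem_cons, List.not_mem_nil, or_false] at hp
  simp only [Vsup, lt_sup_iff]
  rcases hp with rfl | rfl | rfl | rfl | rfl
  · have := approximates_V2.lt_of_gapCoeffs approximates_V1 hs hpos (by norm_num)
    rw [e] at this; tauto
  · have := approximates_V3.lt_of_gapCoeffs approximates_V1 hs hpos (by norm_num)
    rw [e] at this; tauto
  · have := approximates_V4.lt_of_gapCoeffs approximates_V1 hs hpos (by norm_num)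
    rw [e] at this; tauto
  · have := approximates_V5.lt_of_gapCoeffs approximates_V1 hs hpos (by norm_num)
    rw [e] at this; tauto
  · simp only [evalCoeffs, mul_zero, add_zero] at hpos
    push_cast at hpos
    linarith

/-! ### The function `V` on the circle -/

theorem Vsup_eq_or (x : ℝ) :
    Vsup x = V1 x ∨ Vsup x = V2 x ∨ Vsup x = V3 x ∨ Vsup x = V4 x ∨ Vsup x = V5 x := by
  unfold Vsup
  rcases max_choice (V1 x ⊔ V2 x ⊔ V3 x ⊔ V4 x) (V5 x) with h | h <;> rw [h]
  · rcases max_choice (V1 x ⊔ V2 x ⊔ V3 x) (V4 x) with h | h <;> rw [h]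
    · rcases max_choice (V1 x ⊔ V2 x) (V3 x) with h | h <;> rw [h]
      · rcases max_choice (V1 x) (V2 x) with h | h <;> rw [h] <;> tauto
      · tauto
    · tauto
  · tauto

theorem V_le_Vsup (x : ℝ) :
    V1 x ≤ Vsup x ∧ V2 x ≤ Vsup x ∧ V3 x ≤ Vsup x ∧ V4 x ≤ Vsup x ∧ V5 x ≤ Vsup x := by
  simp only [Vsup, le_sup_iff, le_refl, true_or, or_true, and_self]

theorem transfer_Vsup_eq_or (τ : ℝ → ℝ) (x : ℝ) :
    transfer τ Vsup x = transfer τ V1 x ∨ transfer τ Vsup x = transfer τ V2 x ∨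
      transfer τ Vsup x = transfer τ V3 x ∨ transfer τ Vsup x = transfer τ V4 x ∨
        transfer τ Vsup x = transfer τ V5 x := by
  simp only [transfer]
  rcases Vsup_eq_or (τ x) with h | h | h | h | h <;> rw [h] <;> tauto

theorem transfer_mono {f g : ℝ → ℝ} (τ : ℝ → ℝ) {x : ℝ} (h : f (τ x) ≤ g (τ x)) :
    transfer τ f x ≤ transfer τ g x := by
  simp only [transfer]
  linarith

theorem transfer_tau1_Vsup_le {x : ℝ} (hx : x ∈ Icc (0 : ℝ) 1) :
    transfer tau1 Vsup x ≤ Vsup x := by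
  obtain ⟨-, h2, h3, h4, h5⟩ := V_le_Vsup x
  rcases transfer_Vsup_eq_or tau1 x with h | h | h | h | h <;> rw [h]
  exacts [h2, h3, h4, h5, (transfer_tau1_V5_lt hx).le]

theorem transfer_tau1_Vsup_lt {x : ℝ} (h0 : 0 ≤ x) (hx : x ≤ 3 / 32) :
    transfer tau1 Vsup x < Vsup x := by
  have h1 := (V_le_Vsup x).1
  obtain ⟨h2, h3, h4, h5⟩ := lt_V1_of_le h0 hx
  rcases transfer_Vsup_eq_or tau1 x with h | h | h | h | h <;> rw [h]
  exacts [h2.trans_le h1, h3.trans_le h1, h4.trans_le h1, h5.trans_le h1,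
    transfer_tau1_V5_lt ⟨h0, by linarith⟩]

theorem transfer_tau2_Vsup_le {x : ℝ} (hx : x ∈ Icc (0 : ℝ) 1) :
    transfer tau2 Vsup x ≤ Vsup x := by
  rcases transfer_Vsup_eq_or tau2 x with h | h | h | h | h <;> rw [h]
  · exact (transfer_tau2_V1_lt hx).le
  · exact (transfer_tau2_V2_lt hx).le
  · exact (transfer_tau2_V3_lt hx).le
  · rw [← V1_eq_transfer_V4]
    exact (V_le_Vsup x).1
  · exact (transfer_tau2_V5_lt hx).le

theorem transfer_tau2_Vsup_lt {x : ℝ} (hx : 1 / 8 ≤ x) (h1 : x ≤ 1) :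
    transfer tau2 Vsup x < Vsup x := by
  have hx' : x ∈ Icc (0 : ℝ) 1 := ⟨by linarith, h1⟩
  rcases transfer_Vsup_eq_or tau2 x with h | h | h | h | h <;> rw [h]
  · exact transfer_tau2_V1_lt hx'
  · exact transfer_tau2_V2_lt hx'
  · exact transfer_tau2_V3_lt hx'
  · rw [← V1_eq_transfer_V4]
    exact V1_lt_Vsup_of_le hx h1
  · exact transfer_tau2_V5_lt hx'

/-- Whichever `V` attains the supremum at `x` is the transfer of another one, so it is at most the
transfer of `Vsup` along the same branch. -/
theorem Vsup_eq_transfer {x : ℝ} (hx : x ∈ Icc (0 : ℝ) 1) :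
    Vsup x = transfer tau1 Vsup x ∨ Vsup x = transfer tau2 Vsup x := by
  obtain ⟨h1, h2, h3, h4, -⟩ := V_le_Vsup (tau1 x)
  rcases Vsup_eq_or x with h | h | h | h | h
  · right
    refine le_antisymm ?_ (transfer_tau2_Vsup_le hx)
    rw [h]
    conv_lhs => rw [V1_eq_transfer_V4]
    exact transfer_mono _ (V_le_Vsup (tau2 x)).2.2.2.1
  · exact Or.inl (le_antisymm (h.le.trans (transfer_mono tau1 h1)) (transfer_tau1_Vsup_le hx))
  · exact Or.inl (le_antisymm (h.le.trans (transfer_mono tau1 h2)) (transfer_tau1_Vsup_le hx))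
  · exact Or.inl (le_antisymm (h.le.trans (transfer_mono tau1 h3)) (transfer_tau1_Vsup_le hx))
  · exact Or.inl (le_antisymm (h.le.trans (transfer_mono tau1 h4)) (transfer_tau1_Vsup_le hx))

theorem orbitAverage_pos : 0 < orbitAverage := by
  have := abs_le.1 abs_orbitAverage_sub_le
  linarith [this.1]

theorem Vsup_zero : Vsup 0 = V1 0 := by
  obtain ⟨h2, h3, h4, h5⟩ := lt_V1_of_le (x := 0) le_rfl (by norm_num)
  simp only [Vsup, sup_eq_left.2 h2.le, sup_eq_left.2 h3.le, sup_eq_left.2 h4.le,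
    sup_eq_left.2 h5.le]

theorem Vsup_one : Vsup 1 = V5 1 := by
  obtain ⟨h2, h3, h4⟩ := le_V5_one
  -- 1 is fixed by `tau2` and `A` vanishes there, so `V1 1 = V4 1 - m̂ < V4 1`.
  have h1 : V1 1 ≤ V5 1 := by
    have e := V1_add_orbitAverage 1
    have hA : sinPot (tau2 1) = 0 := by norm_num [sinPot, tau2, Real.sin_two_pi]
    have ht : tau2 1 = 1 := by norm_num [tau2]
    rw [hA, ht] at e
    linarith [orbitAverage_pos]
  exact sup_eq_right.2 (sup_le (sup_le (sup_le h1 h2) h3) h4)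

/-- Both ends come from `V4` at the common preimage `1/2 = tau2 0 = tau1 1`. -/
theorem Vsup_zero_eq_one : Vsup 0 = Vsup 1 := by
  rw [Vsup_zero, Vsup_one, V5_eq, V1_eq_transfer_V4]
  simp only [transfer, tau1, tau2, zero_add]

/-- The function `V` on the circle. -/
noncomputable def circleV : UnitAddCircle → ℝ := AddCircle.liftIco 1 0 Vsup

theorem continuous_circleV : Continuous circleV :=
  AddCircle.liftIco_zero_continuous Vsup_zero_eq_one continuous_Vsup.continuousOn

theorem circleV_coe {x : ℝ} (hx : x ∈ Icc (0 : ℝ) 1) : circleV (x : UnitAddCircle) = Vsup x := by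
  rcases hx.2.eq_or_lt with rfl | h1
  · have : ((1 : ℝ) : UnitAddCircle) = ((0 : ℝ) : UnitAddCircle) := by
      simp [AddCircle.coe_period]
    rw [this, ← Vsup_zero_eq_one]
    exact AddCircle.liftIco_zero_coe_apply ⟨le_rfl, one_pos⟩
  · exact AddCircle.liftIco_zero_coe_apply ⟨hx.1, h1⟩

theorem continuous_sinPotCircle : Continuous sinPotCircle :=
  continuous_quot_lift _ continuous_sinPot

theorem continuous_doublingMap : Continuous doublingMap := by
  unfold doublingMap
  fun_prop

theorem doublingMap_coe (x : ℝ) :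
    doublingMap (x : UnitAddCircle) = ((2 * x : ℝ) : UnitAddCircle) := by
  simp [doublingMap, two_smul, two_mul]

theorem coe_sub_one (x : ℝ) : ((x - 1 : ℝ) : UnitAddCircle) = (x : UnitAddCircle) := by
  have := AddCircle.coe_period (1 : ℝ)
  simp [this]

theorem exists_coe_mem_Ico (y : UnitAddCircle) :
    ∃ x ∈ Ico (0 : ℝ) 1, (x : UnitAddCircle) = y := by
  obtain ⟨x, hx, rfl⟩ := AddCircle.coe_image_Ico_eq (1 : ℝ) 0 ▸ mem_univ y
  exact ⟨x, by simpa using hx, rfl⟩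

theorem doublingMap_tau1 (x : ℝ) :
    doublingMap (tau1 x : UnitAddCircle) = (x : UnitAddCircle) := by
  rw [doublingMap_coe, tau1, mul_div_cancel₀ _ two_ne_zero]

theorem doublingMap_tau2 (x : ℝ) :
    doublingMap (tau2 x : UnitAddCircle) = (x : UnitAddCircle) := by
  rw [doublingMap_coe, tau2, mul_div_cancel₀ _ two_ne_zero, ← coe_sub_one, add_sub_cancel_right]

theorem exists_eq_tau {z : ℝ} (hz : z ∈ Ico (0 : ℝ) 1) :
    ∃ x ∈ Ico (0 : ℝ) 1, z = tau1 x ∨ z = tau2 x := by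
  rcases lt_or_ge z (1 / 2) with h | h
  · exact ⟨2 * z, ⟨by linarith [hz.1], by linarith⟩, Or.inl (by rw [tau1]; ring)⟩
  · exact ⟨2 * z - 1, ⟨by linarith, by linarith [hz.2]⟩, Or.inr (by rw [tau2]; ring)⟩

theorem tau1_mem {x : ℝ} (hx : x ∈ Icc (0 : ℝ) 1) : tau1 x ∈ Icc (0 : ℝ) 1 := by
  rw [tau1]; exact ⟨by linarith [hx.1], by linarith [hx.2]⟩

theorem tau2_mem {x : ℝ} (hx : x ∈ Icc (0 : ℝ) 1) : tau2 x ∈ Icc (0 : ℝ) 1 := by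
  rw [tau2]; exact ⟨by linarith [hx.1], by linarith [hx.2]⟩

theorem sinPotCircle_coe_eq (x : ℝ) : sinPotCircle (x : UnitAddCircle) = sinPot x := rfl

/-- The defect of the subaction `V`. -/
noncomputable def defect (y : UnitAddCircle) : ℝ :=
  circleV (doublingMap y) - (sinPotCircle y + circleV y - orbitAverage)

theorem continuous_defect : Continuous defect :=
  (continuous_circleV.comp continuous_doublingMap).sub
    ((continuous_sinPotCircle.add continuous_circleV).sub continuous_const)

theorem defect_tau1 {x : ℝ} (hx : x ∈ Icc (0 : ℝ) 1) :
    defect (tau1 x : UnitAddCircle) = Vsup x - transfer tau1 Vsup x := by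
  rw [defect, doublingMap_tau1, circleV_coe hx, circleV_coe (tau1_mem hx), sinPotCircle_coe_eq,
    transfer, add_comm (sinPot _)]

theorem defect_tau2 {x : ℝ} (hx : x ∈ Icc (0 : ℝ) 1) :
    defect (tau2 x : UnitAddCircle) = Vsup x - transfer tau2 Vsup x := by
  rw [defect, doublingMap_tau2, circleV_coe hx, circleV_coe (tau2_mem hx), sinPotCircle_coe_eq,
    transfer, add_comm (sinPot _)]

theorem defect_nonneg (y : UnitAddCircle) : 0 ≤ defect y := by
  obtain ⟨z, hz, rfl⟩ := exists_coe_mem_Ico y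
  obtain ⟨x, hx, rfl | rfl⟩ := exists_eq_tau hz
  · rw [defect_tau1 (Ico_subset_Icc_self hx)]
    exact sub_nonneg.2 (transfer_tau1_Vsup_le (Ico_subset_Icc_self hx))
  · rw [defect_tau2 (Ico_subset_Icc_self hx)]
    exact sub_nonneg.2 (transfer_tau2_Vsup_le (Ico_subset_Icc_self hx))

theorem mem_Icc_of_defect_eq_zero {z : ℝ} (hz : z ∈ Ico (0 : ℝ) 1)
    (h : defect (z : UnitAddCircle) = 0) : z ∈ Icc (3 / 64 : ℝ) (9 / 16) := by
  obtain ⟨x, hx, rfl | rfl⟩ := exists_eq_tau hz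
  · rw [defect_tau1 (Ico_subset_Icc_self hx)] at h
    have : 3 / 32 < x := by
      by_contra! hlt
      linarith [transfer_tau1_Vsup_lt hx.1 hlt]
    rw [tau1]
    exact ⟨by linarith, by linarith [hx.2]⟩
  · rw [defect_tau2 (Ico_subset_Icc_self hx)] at h
    have : x < 1 / 8 := by
      by_contra! hlt
      linarith [transfer_tau2_Vsup_lt hlt hx.2.le]
    rw [tau2]
    exact ⟨by linarith [hx.1], by linarith⟩

theorem isGreatest_circleV (x : UnitAddCircle) :
    IsGreatest {r : ℝ | ∃ y : UnitAddCircle,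
      doublingMap y = x ∧ r = sinPotCircle y + circleV y - orbitAverage} (circleV x) := by
  constructor
  · obtain ⟨x, hx, rfl⟩ := exists_coe_mem_Ico x
    have hx' := Ico_subset_Icc_self hx
    rcases Vsup_eq_transfer hx' with h | h
    · refine ⟨(tau1 x : UnitAddCircle), doublingMap_tau1 x, ?_⟩
      rw [circleV_coe hx', h, circleV_coe (tau1_mem hx'), sinPotCircle_coe_eq, transfer,
        add_comm (sinPot _)]
    · refine ⟨(tau2 x : UnitAddCircle), doublingMap_tau2 x, ?_⟩
      rw [circleV_coe hx', h, circleV_coe (tau2_mem hx'), sinPotCircle_coe_eq, transfer,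
        add_comm (sinPot _)]
  · rintro r ⟨y, rfl, rfl⟩
    exact sub_nonneg.1 (defect_nonneg y)

/-! ### Points whose whole orbit stays in the arc `[3/64, 9/16]` -/

/-- The defect vanishes along the whole forward orbit of `x`. -/
def NoDefect (x : ℝ) : Prop := ∀ n : ℕ, defect (doublingMap^[n] (x : UnitAddCircle)) = 0

theorem NoDefect.two_mul {x : ℝ} (h : NoDefect x) : NoDefect (2 * x) := by
  intro n
  rw [← doublingMap_coe, ← Function.iterate_succ_apply]
  exact h (n + 1)

theorem NoDefect.sub_one {x : ℝ} (h : NoDefect x) : NoDefect (x - 1) := by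
  intro n
  rw [coe_sub_one]
  exact h n

theorem NoDefect.mem_Icc {x : ℝ} (h : NoDefect x) (h0 : 0 ≤ x) (h1 : x < 1) :
    x ∈ Icc (3 / 64 : ℝ) (9 / 16) :=
  mem_Icc_of_defect_eq_zero ⟨h0, h1⟩ (h 0)

theorem NoDefect.false_of_mem {x : ℝ} (h : NoDefect x) (h0 : 3 / 8 ≤ x) (h1 : x ≤ 1 / 2) :
    False := by
  rcases h1.eq_or_lt with rfl | hlt
  · have := (h.two_mul.sub_one.mem_Icc (by norm_num) (by norm_num)).1
    norm_num at this
  · have := (h.two_mul.mem_Icc (by linarith) (by linarith)).2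
    linarith

theorem NoDefect.lt_of_le {x : ℝ} (h : NoDefect x) (h0 : 0 ≤ x) (h1 : x ≤ 1 / 8) :
    3 / 64 ≤ x ∧ x < 3 / 32 :=
  ⟨(h.mem_Icc h0 (by linarith)).1, not_le.1 fun h2 =>
    h.two_mul.two_mul.false_of_mem (by linarith) (by linarith)⟩

theorem NoDefect.return {x : ℝ} (h : NoDefect x) (h0 : 0 ≤ x) (h1 : x ≤ 1 / 8) :
    NoDefect (16 * x - 1) ∧ 0 ≤ 16 * x - 1 ∧ 16 * x - 1 ≤ 1 / 8 := by
  obtain ⟨ha, hb⟩ := h.lt_of_le h0 h1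
  have h8 := h.two_mul.two_mul.two_mul
  have h8' := (h8.mem_Icc (by linarith) (by linarith)).2
  have h16 := h8.two_mul
  have e : 2 * (2 * (2 * (2 * x))) = 16 * x := by ring
  rw [e] at h16
  refine ⟨h16.sub_one, ?_, by linarith⟩
  by_contra! hlt
  have := (h16.mem_Icc (by linarith) (by linarith)).2
  linarith

theorem NoDefect.eq_of_le {x : ℝ} (h : NoDefect x) (h0 : 0 ≤ x) (h1 : x ≤ 1 / 8) :
    x = 1 / 15 := by
  have key : ∀ n : ℕ, ∀ x : ℝ, NoDefect x → 0 ≤ x → x ≤ 1 / 8 →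
      |x - 1 / 15| ≤ (1 / 16) ^ n := by
    intro n
    induction n with
    | zero =>
      intro x _ h0 h1
      rw [pow_zero, abs_le]
      constructor <;> linarith
    | succ n ih =>
      intro x h h0 h1
      obtain ⟨hr, hr0, hr1⟩ := h.return h0 h1
      have := abs_le.1 (ih _ hr hr0 hr1)
      rw [pow_succ, abs_le]
      constructor <;> linarith [this.1, this.2]
  have hlim := ge_of_tendsto'
    (tendsto_pow_atTop_nhds_zero_of_lt_one (r := (1 / 16 : ℝ)) (by norm_num) (by norm_num))
    (fun n => key n x h h0 h1)
  linarith [abs_eq_zero.1 (le_antisymm hlim (abs_nonneg _))]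

theorem NoDefect.eq_or {x : ℝ} (h : NoDefect x) (h0 : 0 ≤ x) (h1 : x < 1) :
    x = 1 / 15 ∨ x = 2 / 15 ∨ x = 4 / 15 ∨ x = 8 / 15 := by
  have hx := (h.mem_Icc h0 h1).2
  have h2 := h.two_mul
  have h4 := h2.two_mul
  have h8 := h4.two_mul
  rcases le_or_gt x (1 / 8) with ha | ha
  · exact Or.inl (h.eq_of_le h0 ha)
  rcases lt_or_ge x (3 / 16) with hb | hb
  · have := (h4.mem_Icc (by linarith) (by linarith)).2
    have := h8.sub_one.eq_of_le (by linarith) (by linarith)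
    right; left; linarith
  rcases le_or_gt x (1 / 4) with hc | hc
  · exact (h2.false_of_mem (by linarith) (by linarith)).elim
  rcases lt_or_ge x (3 / 8) with hd | hd
  · have := (h2.mem_Icc (by linarith) (by linarith)).2
    have := h4.sub_one.eq_of_le (by linarith) (by linarith)
    right; right; left; linarith
  rcases le_or_gt x (1 / 2) with he | he
  · exact (h.false_of_mem (by linarith) (by linarith)).elim
  · have := h2.sub_one.eq_of_le (by linarith) (by linarith)
    right; right; right; linarith

/-! ### The measure on the periodic orbit -/

/-- The invariant probability carried by the periodic orbit. -/
noncomputable def orbitMeasure : Measure UnitAddCircle :=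
  (4⁻¹ : ENNReal) • (Measure.dirac ((1 / 15 : ℝ) : UnitAddCircle) +
    (Measure.dirac ((2 / 15 : ℝ) : UnitAddCircle) +
      (Measure.dirac ((4 / 15 : ℝ) : UnitAddCircle) +
        Measure.dirac ((8 / 15 : ℝ) : UnitAddCircle))))

theorem doublingMap_one : doublingMap ((1 / 15 : ℝ) : UnitAddCircle) = ((2 / 15 : ℝ)) := by
  rw [doublingMap_coe]; norm_num

theorem doublingMap_two : doublingMap ((2 / 15 : ℝ) : UnitAddCircle) = ((4 / 15 : ℝ)) := by
  rw [doublingMap_coe]; norm_num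

theorem doublingMap_four : doublingMap ((4 / 15 : ℝ) : UnitAddCircle) = ((8 / 15 : ℝ)) := by
  rw [doublingMap_coe]; norm_num

theorem doublingMap_eight : doublingMap ((8 / 15 : ℝ) : UnitAddCircle) = ((1 / 15 : ℝ)) := by
  rw [doublingMap_coe, ← coe_sub_one]; norm_num

theorem coe_ne_coe {x y : ℝ} (hx : x ∈ Ico (0 : ℝ) 1) (hy : y ∈ Ico (0 : ℝ) 1) (h : x ≠ y) :
    (x : UnitAddCircle) ≠ (y : UnitAddCircle) := by
  have : Fact ((0 : ℝ) < 1) := ⟨one_pos⟩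
  rw [Ne, AddCircle.coe_eq_coe_iff_of_mem_Ico (a := 0) (by simpa using hx) (by simpa using hy)]
  exact h

instance isProbabilityMeasure_orbitMeasure : IsProbabilityMeasure orbitMeasure := by
  constructor
  simp only [orbitMeasure, Measure.smul_apply, Measure.add_apply, measure_univ, smul_eq_mul]
  norm_num
  exact ENNReal.inv_mul_cancel (by norm_num) (by norm_num)

theorem isInvariantProb_orbitMeasure : IsInvariantProb orbitMeasure := by
  have hm := continuous_doublingMap.measurable
  refine ⟨inferInstance, hm, ?_⟩
  rw [orbitMeasure, Measure.map_smul, Measure.map_add _ _ hm, Measure.map_add _ _ hm,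
    Measure.map_add _ _ hm, Measure.map_dirac' hm, Measure.map_dirac' hm, Measure.map_dirac' hm,
    Measure.map_dirac' hm, doublingMap_one, doublingMap_two, doublingMap_four, doublingMap_eight]
  congr 1
  abel

theorem Continuous.integrable_unitAddCircle {f : UnitAddCircle → ℝ} (hf : Continuous f)
    (ρ : Measure UnitAddCircle) [IsFiniteMeasure ρ] : Integrable f ρ :=
  hf.integrable_of_hasCompactSupport (HasCompactSupport.of_compactSpace f)

theorem integral_orbitMeasure : ∫ x, sinPotCircle x ∂orbitMeasure = orbitAverage := by
  have hi := fun ρ [IsFiniteMeasure ρ] => continuous_sinPotCircle.integrable_unitAddCircle ρ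
  rw [orbitMeasure, integral_smul_measure, integral_add_measure (hi _) (hi _),
    integral_add_measure (hi _) (hi _), integral_add_measure (hi _) (hi _), integral_dirac,
    integral_dirac, integral_dirac, integral_dirac]
  simp only [sinPotCircle_coe_eq, orbitAverage, ENNReal.toReal_inv, smul_eq_mul]
  norm_num
  ring

theorem isClosed_orbit15 : IsClosed orbit15 :=
  (((finite_singleton _).insert _).insert _ |>.insert _).isClosed

theorem support_orbitMeasure : orbitMeasure.support = orbit15 := by
  apply Subset.antisymm
  · refine Measure.support_subset_of_isClosed isClosed_orbit15 ?_
    rw [mem_ae_iff, orbitMeasure]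
    simp [orbit15]
  · intro x hx
    rw [Measure.mem_support_iff_forall]
    intro U hU
    refine lt_of_lt_of_le ?_ (measure_mono (singleton_subset_iff.2 (mem_of_mem_nhds hU)))
    rw [orbitMeasure, Measure.smul_apply, smul_eq_mul]
    refine ENNReal.mul_pos (by simp) ?_
    rcases hx with rfl | rfl | rfl | rfl <;> simp

/-! ### Maximizing probabilities -/

theorem integral_defect {ρ : Measure UnitAddCircle} (hρ : IsInvariantProb ρ) :
    ∫ y, defect y ∂ρ = orbitAverage - ∫ y, sinPotCircle y ∂ρ := by
  have := hρ.1
  have hV : ∫ y, circleV (doublingMap y) ∂ρ = ∫ y, circleV y ∂ρ := by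
    have := integral_map (μ := ρ) continuous_doublingMap.measurable.aemeasurable
      (f := circleV) continuous_circleV.aestronglyMeasurable
    rw [← this, hρ.2.map_eq]
  have hA := continuous_sinPotCircle.integrable_unitAddCircle ρ
  have hVi := continuous_circleV.integrable_unitAddCircle ρ
  have hVT : Integrable (fun y => circleV (doublingMap y)) ρ :=
    (continuous_circleV.comp continuous_doublingMap).integrable_unitAddCircle ρ
  have hAV : Integrable (fun y => sinPotCircle y + circleV y) ρ := hA.add hVi
  have hc : Integrable (fun _ : UnitAddCircle => orbitAverage) ρ := integrable_const _
  have hAVc : Integrable (fun y => sinPotCircle y + circleV y - orbitAverage) ρ := hAV.sub hc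
  unfold defect
  rw [integral_sub hVT hAVc, integral_sub hAV hc, integral_add hA hVi, hV]
  simp
  ring

theorem maxErgodicValue_sinPotCircle : maxErgodicValue sinPotCircle = orbitAverage := by
  refine IsGreatest.csSup_eq ⟨⟨orbitMeasure, isInvariantProb_orbitMeasure,
    integral_orbitMeasure.symm⟩, ?_⟩
  rintro r ⟨ρ, hρ, rfl⟩
  have h := integral_defect hρ
  have h0 : 0 ≤ ∫ y, defect y ∂ρ := integral_nonneg defect_nonneg
  linarith

theorem isMaximizingProb_orbitMeasure : IsMaximizingProb sinPotCircle orbitMeasure :=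
  ⟨isInvariantProb_orbitMeasure, by rw [integral_orbitMeasure, maxErgodicValue_sinPotCircle]⟩

theorem ae_mem_orbit15 {ν : Measure UnitAddCircle} (hν : IsMaximizingProb sinPotCircle ν) :
    ∀ᵐ y ∂ν, y ∈ orbit15 := by
  have := hν.1.1
  have h0 : ∫ y, defect y ∂ν = 0 := by
    rw [integral_defect hν.1, hν.2, maxErgodicValue_sinPotCircle, sub_self]
  have h1 : ∀ᵐ y ∂ν, defect y = 0 := by
    have := (integral_eq_zero_iff_of_nonneg defect_nonneg
      (continuous_defect.integrable_unitAddCircle ν)).1 h0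
    exact this
  have h2 : ∀ᵐ y ∂ν, ∀ n : ℕ, defect (doublingMap^[n] y) = 0 :=
    ae_all_iff.2 fun n => (hν.1.2.iterate n).quasiMeasurePreserving.ae h1
  filter_upwards [h2] with y hy
  obtain ⟨z, hz, rfl⟩ := exists_coe_mem_Ico y
  have hz' : NoDefect z := hy
  rcases hz'.eq_or hz.1 hz.2 with rfl | rfl | rfl | rfl <;> simp [orbit15]

theorem eq_orbitMeasure {ν : Measure UnitAddCircle} (hν : IsMaximizingProb sinPotCircle ν) :
    ν = orbitMeasure := by
  have := hν.1.1
  have hae := ae_mem_orbit15 hν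
  set a : UnitAddCircle := ((1 / 15 : ℝ) : UnitAddCircle)
  set b : UnitAddCircle := ((2 / 15 : ℝ) : UnitAddCircle)
  set c : UnitAddCircle := ((4 / 15 : ℝ) : UnitAddCircle)
  set d : UnitAddCircle := ((8 / 15 : ℝ) : UnitAddCircle)
  have hab : a ≠ b := coe_ne_coe (by norm_num) (by norm_num) (by norm_num)
  have hac : a ≠ c := coe_ne_coe (by norm_num) (by norm_num) (by norm_num)
  have had : a ≠ d := coe_ne_coe (by norm_num) (by norm_num) (by norm_num)
  have hbc : b ≠ c := coe_ne_coe (by norm_num) (by norm_num) (by norm_num)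
  have hbd : b ≠ d := coe_ne_coe (by norm_num) (by norm_num) (by norm_num)
  have hcd : c ≠ d := coe_ne_coe (by norm_num) (by norm_num) (by norm_num)
  have hTa : doublingMap a = b := doublingMap_one
  have hTb : doublingMap b = c := doublingMap_two
  have hTc : doublingMap c = d := doublingMap_four
  have hTd : doublingMap d = a := doublingMap_eight
  have hmem : ∀ y ∈ orbit15, y = a ∨ y = b ∨ y = c ∨ y = d := fun y hy => hy
  have hae' : ∀ᵐ y ∂ν, y ∈ ({a} ∪ ({b} ∪ ({c} ∪ {d})) : Set UnitAddCircle) := hae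
  have hdef : orbitMeasure = (4⁻¹ : ENNReal) • (Measure.dirac a + (Measure.dirac b +
      (Measure.dirac c + Measure.dirac d))) := rfl
  clear_value a b c d
  have step : ∀ p q : UnitAddCircle, (∀ y ∈ orbit15, doublingMap y = q ↔ y = p) →
      ν {q} = ν {p} := by
    intro p q h
    rw [← hν.1.2.measure_preimage (measurableSet_singleton q).nullMeasurableSet]
    refine measure_congr ?_
    filter_upwards [hae] with y hy
    exact propext (h y hy)
  have e1 : ν {b} = ν {a} := step a b (by
    intro y hy
    rcases hmem y hy with rfl | rfl | rfl | rfl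
    · simp [hTa]
    · simp [hTb, hbc.symm, hab.symm]
    · simp [hTc, hbd.symm, hac.symm]
    · simp [hTd, hab, had.symm])
  have e2 : ν {c} = ν {a} := (step b c (by
    intro y hy
    rcases hmem y hy with rfl | rfl | rfl | rfl
    · simp [hTa, hbc, hab]
    · simp [hTb]
    · simp [hTc, hcd.symm, hbc.symm]
    · simp [hTd, hac, hbd.symm])).trans e1
  have e3 : ν {d} = ν {a} := (step c d (by
    intro y hy
    rcases hmem y hy with rfl | rfl | rfl | rfl
    · simp [hTa, hbd, hac]
    · simp [hTb, hcd, hbc]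
    · simp [hTc]
    · simp [hTd, had, hcd.symm])).trans e2
  have hdec : ν = ν {a} • (Measure.dirac a + (Measure.dirac b + (Measure.dirac c +
      Measure.dirac d))) := by
    have hsing : ∀ s : UnitAddCircle, MeasurableSet {s} := fun s => measurableSet_singleton s
    have h1 : ν.restrict ({a} ∪ ({b} ∪ ({c} ∪ {d}))) = ν :=
      Measure.restrict_eq_self_of_ae_mem hae'
    rw [Measure.restrict_union (by simp [hab, hac, had])
        ((hsing b).union ((hsing c).union (hsing d))),
      Measure.restrict_union (by simp [hbc, hbd]) ((hsing c).union (hsing d)),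
      Measure.restrict_union (by simp [hcd]) (hsing d),
      Measure.restrict_singleton, Measure.restrict_singleton, Measure.restrict_singleton,
      Measure.restrict_singleton, e1, e2, e3] at h1
    rw [smul_add, smul_add, smul_add]
    exact h1.symm
  have hmass : ν {a} = 4⁻¹ := by
    have h1 : ν univ = 1 := measure_univ
    rw [hdec] at h1
    simp only [Measure.smul_apply, Measure.add_apply, measure_univ, smul_eq_mul] at h1
    rw [show (1 : ENNReal) + (1 + (1 + 1)) = 4 by norm_num] at h1
    exact ENNReal.eq_inv_of_mul_eq_one_left h1
  rw [hdec, hmass, hdef]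

theorem mainTheorem3 :
    (∃ μ : Measure UnitAddCircle,
      IsMaximizingProb sinPotCircle μ ∧ μ.support = orbit15 ∧
        ∀ ν : Measure UnitAddCircle, IsMaximizingProb sinPotCircle ν → ν = μ) ∧
    maxErgodicValue sinPotCircle =
      (sinPotCircle ((1 / 15 : ℝ) : UnitAddCircle) + sinPotCircle ((2 / 15 : ℝ) : UnitAddCircle) +
        sinPotCircle ((4 / 15 : ℝ) : UnitAddCircle) +
        sinPotCircle ((8 / 15 : ℝ) : UnitAddCircle)) / 4 ∧
    (∀ x ∈ Icc (0 : ℝ) 1, Summable (V1term x)) ∧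
    (∀ x ∈ Icc (0 : ℝ) 1, V1 x + orbitAverage = V4 (tau2 x) + sinPot (tau2 x)) ∧
    (∃ V : UnitAddCircle → ℝ,
      (∀ x ∈ Icc (0 : ℝ) 1, V (x : UnitAddCircle) = Vsup x) ∧
        IsCalibratedSubaction sinPotCircle V) := by
  refine ⟨⟨orbitMeasure, isMaximizingProb_orbitMeasure, support_orbitMeasure,
    fun ν hν => eq_orbitMeasure hν⟩, maxErgodicValue_sinPotCircle,
    fun x _ => summable_V1term x, fun x _ => V1_add_orbitAverage x,
    circleV, fun x hx => circleV_coe hx, continuous_circleV, ?_⟩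
  rw [maxErgodicValue_sinPotCircle]
  exact isGreatest_circleV
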